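/- Let $L_j^{\alpha}(x)=\sum_{i=0}^{j}(-1)^i\binom{j+\alpha}{j-i}\frac{x^i}{i!}$ denote the Laguerre polynomials and let the complex Hermite polynomials be $$H_{j,r}(z,\bar z)=\begin{cases}\sqrt{\frac{r!}{j!}}\,\pi^{\frac{j-r}{2}}\,z^{j-r}\,L_r^{j-r}(\pi|z|^2), & j>r\ge 0,\\[4pt] (-1)^{r-j}\sqrt{\frac{j!}{r!}}\,\pi^{\frac{r-j}{2}}\,\bar z^{\,r-j}\,L_j^{r-j}(\pi|z|^2), & 0\le j\le r.\end{cases}$$ For integers $r,N\ge 0$, let $\rho_{r,N}(z)=K_{r,N}(z,z)$ be the one-point intensity of the finite $(r,N)$-pure polyanalytic Ginibre ensemble, i.e. of the determinantal point process on $\mathbb{C}\cong\mathbb{R}^2$ with correlation kernel $$K_{r,N}(z,z')=e^{-\frac{\pi}{2}(|z|^2+|z'|^2)}\sum_{j=0}^{N-1}H_{j,r}(z,\bar z)\,\overline{H_{j,r}(z',\overline{z'})}.$$ Write $\mathbb{D}_R$ for the disk of radius $R$ centred at $0$, and $\mathbb{D}=\mathbb{D}_1$. Then, for each fixed Landau level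 $r\in\{0,1,2,\dots\}$, $$\rho_{r,N}\Big(\sqrt{\tfrac{N}{\pi}}\;\cdot\Big)\longrightarrow 1_{\mathbb{D}}\quad\text{in }L^1(\mathbb{R}^2)\text{ as }N\to\infty .$$ Moreover, there is a constant $C_r$, depending only on $r$, such that for all $N$ $$\big\|\rho_{r,N}-1_{\mathbb{D}_{\sqrt{N/\pi}}}\big\|_{L^1(\mathbb{R}^2)}\le C_r\sqrt{N}.$$ -/

import Mathlib

open MeasureTheory Filter Topology
open scoped Nat ENNReal

noncomputable section

/-- The generalized Laguerre polynomial
`L_j^α(x) = ∑_{i=0}^{j} (-1)^i * binom(j+α, j-i) * x^i / i!`, for an integer parameter `α ≥ 0`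
(the only parameters that occur in the complex Hermite polynomials). -/
def laguerre (j α : ℕ) (x : ℝ) : ℝ :=
  ∑ i ∈ Finset.range (j + 1), (-1 : ℝ) ^ i * ((j + α).choose (j - i) : ℝ) * x ^ i / (i ! : ℝ)

/-- The complex Hermite polynomial `H_{j,r}(z, z̄)`, orthonormal with respect to
`exp (-π |z|²) dz`; here `√π ^ m` is `π ^ (m / 2)`. -/
def complexHermite (j r : ℕ) (z : ℂ) : ℂ :=
  if r < j then
    ((√((r ! : ℝ) / (j ! : ℝ)) * √Real.pi ^ (j - r) : ℝ) : ℂ) * z ^ (j - r)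
      * ((laguerre r (j - r) (Real.pi * ‖z‖ ^ 2) : ℝ) : ℂ)
  else
    (-1 : ℂ) ^ (r - j) * ((√((j ! : ℝ) / (r ! : ℝ)) * √Real.pi ^ (r - j) : ℝ) : ℂ)
      * (starRingEnd ℂ z) ^ (r - j) * ((laguerre j (r - j) (Real.pi * ‖z‖ ^ 2) : ℝ) : ℂ)

/-- The correlation kernel `K_{r,N}` of the finite `(r,N)`-pure polyanalytic Ginibre ensemble. -/
def pureKernel (r N : ℕ) (z w : ℂ) : ℂ :=
  ((Real.exp (-(Real.pi / 2) * (‖z‖ ^ 2 + ‖w‖ ^ 2)) : ℝ) : ℂ) *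
    ∑ j ∈ Finset.range N, complexHermite j r z * starRingEnd ℂ (complexHermite j r w)

/-- The `n`-point intensity (correlation function) `det (K(x_j, x_k))_{j,k}` of the
determinantal point process on `ℂ` with correlation kernel `K`. -/
def intensity (K : ℂ → ℂ → ℂ) (n : ℕ) (x : Fin n → ℂ) : ℂ :=
  (Matrix.of fun j k => K (x j) (x k)).det

/-- The one-point intensity `ρ_{r,N}` of the finite `(r,N)`-pure polyanalytic Ginibre ensemble,
as a real-valued function; no information is lost in taking the real part, see
`ofReal_pureIntensity`. -/
def pureIntensity (r N : ℕ) (z : ℂ) : ℝ :=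
  (intensity (pureKernel r N) 1 fun _ => z).re

/-- `ρ_{r,N}(z) = K_{r,N}(z, z)`; in particular the diagonal of the kernel is real. -/
theorem ofReal_pureIntensity (r N : ℕ) (z : ℂ) :
    ((pureIntensity r N z : ℝ) : ℂ) = pureKernel r N z z := by
  have h : pureKernel r N z z =
      ((Real.exp (-(Real.pi / 2) * (‖z‖ ^ 2 + ‖z‖ ^ 2)) *
        ∑ j ∈ Finset.range N, Complex.normSq (complexHermite j r z) : ℝ) : ℂ) := by
    simp only [pureKernel, Complex.mul_conj]
    push_cast
    rfl
  have h1 : intensity (pureKernel r N) 1 (fun _ => z) = pureKernel r N z z := by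
    simp [intensity]
  rw [pureIntensity, h1, h, Complex.ofReal_re]

end

/-! In the variable `x = π|z|²` the intensity is a sum over `j < N` of the radial densities
`hermiteDensity j r`, each a probability density on the half-line. The estimate is proved by
induction on the Landau level `r`.

For `r = 0` the sum is the probability that a Poisson variable of mean `x` is less than `N`. Its
antiderivative is explicit, and its distance to the indicator of `x < N` is `2 e^{-N} N^N / (N-1)!`
for `N ≥ 1`, at most `√N` by Stirling.

Passing from level `r` to `r + 1`, the difference of the two densities with the same `j` is a
discrete derivative in `j` (`hermiteDensity_sub_hermiteDensity`), so the sum over `j < N` telescopes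
to one boundary term, `levelDifference r N`. For `N ≥ 1` its square is `N/(r+1)` times a product of
two normalized densities, so by AM-GM its `L¹` norm is at most `√N`. Each level thus costs one more
`√N`, giving `(r + 1)√N`. Polar coordinates transfer this to the plane, and rescaling by `√(N/π)`
leaves `O(1/√N)`. -/

/-! ### Laguerre polynomials: recurrences, derivatives and symmetry -/

/-- The Laguerre polynomial `L_r^(j-r)`, for arbitrary `j, r ≥ 0`. -/
noncomputable def shiftedLaguerre (j r : ℕ) (x : ℝ) : ℝ :=
  ∑ i ∈ Finset.range (r + 1), (-1 : ℝ) ^ i * (j.choose (r - i) : ℝ) * x ^ i / (i ! : ℝ)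

theorem shiftedLaguerre_zero (j : ℕ) (x : ℝ) : shiftedLaguerre j 0 x = 1 := by
  simp [shiftedLaguerre]

theorem laguerre_eq_shiftedLaguerre (r α : ℕ) (x : ℝ) :
    laguerre r α x = shiftedLaguerre (r + α) r x := rfl

/-- Pascal's rule, term by term; the terms of top degree agree on their own. -/
theorem shiftedLaguerre_succ_left (j r : ℕ) (x : ℝ) :
    shiftedLaguerre (j + 1) (r + 1) x = shiftedLaguerre j (r + 1) x + shiftedLaguerre j r x := by
  unfold shiftedLaguerre
  rw [Finset.sum_range_succ, Finset.sum_range_succ (n := r + 1), add_right_comm,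
    ← Finset.sum_add_distrib]
  congr 1
  · refine Finset.sum_congr rfl fun i hi => ?_
    have h : r + 1 - i = (r - i) + 1 := by have := Finset.mem_range.1 hi; omega
    rw [h, Nat.choose_succ_succ]
    push_cast
    ring
  · simp

/-- Split the factor as `r + 1 = (r + 1 - i) + i` in the `i`-th term: the first part is absorbed
into the binomial coefficient, the second into `i!`. The truncated `j - 1` is harmless, since for `j
= 0` its term carries the factor `0`. -/
theorem shiftedLaguerre_succ_right (j r : ℕ) (x : ℝ) :
    (r + 1) * shiftedLaguerre j (r + 1) x
      = j * shiftedLaguerre (j - 1) r x - x * shiftedLaguerre j r x := by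
  have h1 : ∑ i ∈ Finset.range (r + 2), ((r + 1 - i : ℕ) : ℝ) *
      ((-1 : ℝ) ^ i * (j.choose (r + 1 - i) : ℝ) * x ^ i / (i ! : ℝ))
      = j * shiftedLaguerre (j - 1) r x := by
    rw [Finset.sum_range_succ, shiftedLaguerre, Finset.mul_sum]
    simp only [tsub_self, Nat.cast_zero, zero_mul, add_zero]
    refine Finset.sum_congr rfl fun i hi => ?_
    have h : r + 1 - i = (r - i) + 1 := by have := Finset.mem_range.1 hi; omega
    rw [h]
    have h2 : ((r - i + 1 : ℕ) : ℝ) * (j.choose (r - i + 1) : ℝ)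
        = j * ((j - 1).choose (r - i) : ℝ) := by
      cases j with
      | zero => simp
      | succ k =>
        have := Nat.add_one_mul_choose_eq k (r - i)
        rw [Nat.add_sub_cancel]
        exact_mod_cast (by rw [this]; ring)
    linear_combination ((-1 : ℝ) ^ i * x ^ i / (i ! : ℝ)) * h2
  have h3 : ∑ i ∈ Finset.range (r + 2), (i : ℝ) *
      ((-1 : ℝ) ^ i * (j.choose (r + 1 - i) : ℝ) * x ^ i / (i ! : ℝ))
      = - x * shiftedLaguerre j r x := by
    rw [Finset.sum_range_succ', shiftedLaguerre, Finset.mul_sum]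
    simp only [Nat.cast_zero, zero_mul, add_zero]
    refine Finset.sum_congr rfl fun i _ => ?_
    rw [Nat.add_sub_add_right, Nat.factorial_succ]
    push_cast
    field_simp
    ring
  have h4 : (r + 1) * shiftedLaguerre j (r + 1) x
      = ∑ i ∈ Finset.range (r + 2), ((r + 1 - i : ℕ) : ℝ) *
          ((-1 : ℝ) ^ i * (j.choose (r + 1 - i) : ℝ) * x ^ i / (i ! : ℝ))
        + ∑ i ∈ Finset.range (r + 2), (i : ℝ) *
          ((-1 : ℝ) ^ i * (j.choose (r + 1 - i) : ℝ) * x ^ i / (i ! : ℝ)) := by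
    rw [← Finset.sum_add_distrib, shiftedLaguerre, Finset.mul_sum]
    refine Finset.sum_congr rfl fun i hi => ?_
    rw [Nat.cast_sub (by have := Finset.mem_range.1 hi; omega)]
    push_cast
    ring
  rw [h4, h1, h3]
  ring

theorem hasDerivAt_shiftedLaguerre_zero (j : ℕ) (x : ℝ) :
    HasDerivAt (shiftedLaguerre j 0) 0 x := by
  have : shiftedLaguerre j 0 = fun _ => 1 := funext (shiftedLaguerre_zero j)
  rw [this]
  exact hasDerivAt_const x 1

theorem hasDerivAt_shiftedLaguerre_succ (j r : ℕ) (x : ℝ) :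
    HasDerivAt (shiftedLaguerre j (r + 1)) (-shiftedLaguerre j r x) x := by
  have h : ∀ i ∈ Finset.range (r + 2), HasDerivAt
      (fun x : ℝ => (-1 : ℝ) ^ i * (j.choose (r + 1 - i) : ℝ) * x ^ i / (i ! : ℝ))
      ((-1 : ℝ) ^ i * (j.choose (r + 1 - i) : ℝ) * (i * x ^ (i - 1)) / (i ! : ℝ)) x :=
    fun i _ => ((hasDerivAt_pow i x).const_mul _).div_const _
  have h1 := HasDerivAt.fun_sum h
  refine h1.congr_deriv ?_
  rw [Finset.sum_range_succ', shiftedLaguerre, ← Finset.sum_neg_distrib]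
  simp only [Nat.cast_zero, zero_mul, mul_zero, zero_div, add_zero]
  refine Finset.sum_congr rfl fun i _ => ?_
  rw [Nat.add_sub_add_right, Nat.factorial_succ, Nat.add_sub_cancel]
  push_cast
  field_simp
  ring

/-- The Rodrigues-type relation for `shiftedLaguerre`, in differentiated form. -/
theorem shiftedLaguerre_rodrigues (j r : ℕ) (x : ℝ) :
    (j - (r + 1) - x) * shiftedLaguerre j (r + 1) x - x * shiftedLaguerre j r x
      = (r + 2) * shiftedLaguerre j (r + 2) x := by
  have h1 := shiftedLaguerre_succ_right j (r + 1) x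
  have h2 := shiftedLaguerre_succ_right j r x
  have h3 : (j : ℝ) * shiftedLaguerre j (r + 1) x
      = j * (shiftedLaguerre (j - 1) (r + 1) x + shiftedLaguerre (j - 1) r x) := by
    cases j with
    | zero => simp
    | succ k => rw [shiftedLaguerre_succ_left, Nat.add_sub_cancel]
  push_cast at h1
  linear_combination h3 - h2 - h1

theorem exists_polynomial_shiftedLaguerre (j r : ℕ) :
    ∃ p : Polynomial ℝ, ∀ x, shiftedLaguerre j r x = p.eval x := by
  refine ⟨∑ i ∈ Finset.range (r + 1),
    Polynomial.C ((-1 : ℝ) ^ i * (j.choose (r - i) : ℝ) / (i ! : ℝ)) * Polynomial.X ^ i,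
    fun x => ?_⟩
  rw [Polynomial.eval_finsetSum, shiftedLaguerre]
  refine Finset.sum_congr rfl fun i _ => ?_
  simp only [Polynomial.eval_mul, Polynomial.eval_C, Polynomial.eval_pow, Polynomial.eval_X]
  ring

theorem continuous_shiftedLaguerre (j r : ℕ) : Continuous (shiftedLaguerre j r) := by
  unfold shiftedLaguerre
  fun_prop

/-- The symmetry `r! L_r^(j-r) = (-x)^(r-j) j! L_j^(r-j)`. -/
theorem shiftedLaguerre_symm (j d : ℕ) (x : ℝ) :
    ((j + d) ! : ℝ) * shiftedLaguerre j (j + d) x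
      = (-x) ^ d * (j ! : ℝ) * shiftedLaguerre (j + d) j x := by
  unfold shiftedLaguerre
  -- The terms with `i < d` vanish because their binomial coefficient does; the others are matched
  -- by the shift `i ↦ d + i`.
  rw [show j + d + 1 = d + (j + 1) by ring, Finset.sum_range_add, Finset.sum_eq_zero, zero_add,
    Finset.mul_sum, Finset.mul_sum]
  · refine Finset.sum_congr rfl fun i hi => ?_
    have hi' : i ≤ j := by have := Finset.mem_range.1 hi; omega
    have h1 : j + d - (d + i) = j - i := by omega
    have h2 := Nat.choose_mul_factorial_mul_factorial (n := j) (k := j - i) (by omega)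
    have h3 := Nat.choose_mul_factorial_mul_factorial (n := j + d) (k := j - i) (by omega)
    rw [show j - (j - i) = i by omega] at h2
    rw [show j + d - (j - i) = d + i by omega] at h3
    rw [h1, ← h2, ← h3]
    push_cast
    rw [neg_pow x d, pow_add, pow_add]
    field_simp
  · intro i hi
    have := Finset.mem_range.1 hi
    rw [Nat.choose_eq_zero_of_lt (by omega)]
    simp

theorem hasDerivAt_exp_neg (x : ℝ) : HasDerivAt (fun x => Real.exp (-x)) (-Real.exp (-x)) x := by
  simpa using (hasDerivAt_neg x).exp

/-- Here `j = r + 1 + a`, so differentiating the weight contributes the factor `a + 1 - x` that the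
recurrence needs. This is the raising relation behind the normalization of the densities. -/
theorem hasDerivAt_rodrigues (r a : ℕ) (x : ℝ) :
    HasDerivAt (fun x => Real.exp (-x) * x ^ (a + 1) * shiftedLaguerre (r + 1 + a) r x)
      ((r + 1) * Real.exp (-x) * x ^ a * shiftedLaguerre (r + 1 + a) (r + 1) x) x := by
  have h1 := (hasDerivAt_exp_neg x).mul (hasDerivAt_pow (a + 1) x)
  rw [Nat.add_sub_cancel] at h1
  cases r with
  | zero =>
    refine (h1.mul (hasDerivAt_shiftedLaguerre_zero (0 + 1 + a) x)).congr_deriv ?_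
    have h := shiftedLaguerre_succ_right (0 + 1 + a) 0 x
    simp only [shiftedLaguerre_zero, Pi.mul_apply] at h ⊢
    push_cast at h ⊢
    linear_combination (-Real.exp (-x) * x ^ a) * h
  | succ s =>
    refine (h1.mul (hasDerivAt_shiftedLaguerre_succ (s + 1 + 1 + a) s x)).congr_deriv ?_
    have h := shiftedLaguerre_rodrigues (s + 1 + 1 + a) s x
    simp only [Pi.mul_apply] at h ⊢
    push_cast at h ⊢
    linear_combination (Real.exp (-x) * x ^ a) * h

/-! ### Poisson distribution function -/

/-- The probability that a Poisson variable of mean `x` is less than `n`. -/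
noncomputable def poissonCDF (n : ℕ) (x : ℝ) : ℝ :=
  ∑ k ∈ Finset.range n, Real.exp (-x) * (x ^ k / (k ! : ℝ))

theorem hasDerivAt_poissonCDF_succ (n : ℕ) (x : ℝ) :
    HasDerivAt (poissonCDF (n + 1)) (-(Real.exp (-x) * (x ^ n / (n ! : ℝ)))) x := by
  induction n with
  | zero =>
    have : poissonCDF (0 + 1) = fun x => Real.exp (-x) := by ext; simp [poissonCDF]
    rw [this]
    simpa using hasDerivAt_exp_neg x
  | succ n ih =>
    have : poissonCDF (n + 1 + 1) = fun x => poissonCDF (n + 1) x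
        + Real.exp (-x) * (x ^ (n + 1) / ((n + 1)! : ℝ)) := by
      ext; rw [poissonCDF, Finset.sum_range_succ, poissonCDF]
    rw [this]
    refine (ih.fun_add ((hasDerivAt_exp_neg x).mul
      ((hasDerivAt_pow (n + 1) x).div_const ((n + 1)! : ℝ)))).congr_deriv ?_
    rw [Nat.factorial_succ, Nat.add_sub_cancel]
    push_cast
    field_simp
    ring

theorem poissonCDF_nonneg (n : ℕ) {x : ℝ} (hx : 0 ≤ x) : 0 ≤ poissonCDF n x :=
  Finset.sum_nonneg fun _ _ => by positivity

theorem poissonCDF_le_one (n : ℕ) {x : ℝ} (hx : 0 ≤ x) : poissonCDF n x ≤ 1 := by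
  rw [poissonCDF, ← Finset.mul_sum, Real.exp_neg, inv_mul_le_iff₀ (Real.exp_pos x), mul_one]
  exact Real.sum_le_exp_of_nonneg hx n

theorem poissonCDF_succ_zero (n : ℕ) : poissonCDF (n + 1) 0 = 1 := by
  rw [poissonCDF, Finset.sum_range_succ']
  simp

theorem tendsto_exp_neg_mul_polynomial (p : Polynomial ℝ) :
    Tendsto (fun x => Real.exp (-x) * p.eval x) atTop (𝓝 0) := by
  refine (Polynomial.tendsto_div_exp_atTop p).congr fun x => ?_
  rw [Real.exp_neg, div_eq_inv_mul]

theorem tendsto_exp_neg_mul_pow (k : ℕ) :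
    Tendsto (fun x => Real.exp (-x) * x ^ k) atTop (𝓝 0) := by
  simpa using tendsto_exp_neg_mul_polynomial (Polynomial.X ^ k)

theorem tendsto_mul_poissonCDF (n : ℕ) (a b : ℝ) :
    Tendsto (fun x => (a * x + b) * poissonCDF n x) atTop (𝓝 0) := by
  have := tendsto_exp_neg_mul_polynomial ((Polynomial.C a * Polynomial.X + Polynomial.C b)
    * ∑ k ∈ Finset.range n, Polynomial.C ((k ! : ℝ)⁻¹) * Polynomial.X ^ k)
  refine this.congr fun x => ?_
  simp only [Polynomial.eval_mul, Polynomial.eval_add, Polynomial.eval_finsetSum,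
    Polynomial.eval_C, Polynomial.eval_X, Polynomial.eval_pow, poissonCDF, ← Finset.mul_sum,
    div_eq_inv_mul]
  ring

/-! ### Radial densities and their normalization -/

/-- The density `exp (-π |z|²) |H_{j,r}(z)|²` as a function of `x = π |z|²`. -/
noncomputable def hermiteDensity (j r : ℕ) (x : ℝ) : ℝ :=
  Real.exp (-x) * ((r ! : ℝ) / (j ! : ℝ)) * (x ^ j / x ^ r) * shiftedLaguerre j r x ^ 2

theorem hermiteDensity_nonneg (j r : ℕ) {x : ℝ} (hx : 0 ≤ x) : 0 ≤ hermiteDensity j r x := by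
  unfold hermiteDensity
  positivity

theorem measurable_hermiteDensity (j r : ℕ) : Measurable (hermiteDensity j r) := by
  have := (continuous_shiftedLaguerre j r).measurable
  unfold hermiteDensity
  fun_prop

theorem hermiteDensity_symm_aux (j d : ℕ) {x : ℝ} (hx : 0 < x) :
    hermiteDensity j (j + d) x = hermiteDensity (j + d) j x := by
  have h := shiftedLaguerre_symm j d x
  have h0 : ((j + d) ! : ℝ) ≠ 0 := by positivity
  have h1 : shiftedLaguerre j (j + d) x
      = (-x) ^ d * (j ! : ℝ) * shiftedLaguerre (j + d) j x / ((j + d) ! : ℝ) := by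
    rw [← h]; field_simp
  unfold hermiteDensity
  rw [h1, neg_pow x d, pow_add]
  have h2 : ((-1 : ℝ) ^ d) ^ 2 = 1 := by rw [← pow_mul, mul_comm, pow_mul]; simp
  field_simp
  rw [h2]
  ring

theorem hermiteDensity_symm (j r : ℕ) {x : ℝ} (hx : 0 < x) :
    hermiteDensity j r x = hermiteDensity r j x := by
  rcases le_total j r with h | h
  · obtain ⟨d, rfl⟩ := Nat.exists_eq_add_of_le h
    exact hermiteDensity_symm_aux j d hx
  · obtain ⟨d, rfl⟩ := Nat.exists_eq_add_of_le h
    exact (hermiteDensity_symm_aux r d hx).symm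

/-- At fixed `j`, raising `r` by one changes the density by an exact derivative, namely that of a
multiple of `e^{-x} x^{a+1} L_r L_{r+1}`. This function vanishes at `0` and at infinity, so the
total mass stays that of the Gamma density at `r = 0`. -/
theorem exists_antideriv_hermiteDensity (j r : ℕ) (hr : r ≤ j) :
    ∃ A : ℝ → ℝ, (∀ x, HasDerivAt A (Real.exp (-x) * ((r ! : ℝ) / (j ! : ℝ)) * x ^ (j - r)
      * shiftedLaguerre j r x ^ 2) x) ∧ A 0 = 0 ∧ Tendsto A atTop (𝓝 1) := by
  induction r with
  | zero =>
    refine ⟨fun x => 1 - poissonCDF (j + 1) x, fun x => ?_, ?_, ?_⟩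
    · refine ((hasDerivAt_const x (1 : ℝ)).sub (hasDerivAt_poissonCDF_succ j x)).congr_deriv ?_
      simp [shiftedLaguerre_zero]
      ring
    · simp [poissonCDF_succ_zero]
    · simpa using (tendsto_mul_poissonCDF (j + 1) 0 1).const_sub 1
  | succ r ih =>
    obtain ⟨A, hA, hA0, hA1⟩ := ih (by omega)
    obtain ⟨a, rfl⟩ := Nat.exists_eq_add_of_le hr
    refine ⟨fun x => A x + ((r ! : ℝ) / ((r + 1 + a)! : ℝ)) *
      (Real.exp (-x) * x ^ (a + 1) * shiftedLaguerre (r + 1 + a) r x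
        * shiftedLaguerre (r + 1 + a) (r + 1) x), fun x => ?_, by simp [hA0], ?_⟩
    · refine ((hA x).fun_add (((hasDerivAt_rodrigues r a x).fun_mul
        (hasDerivAt_shiftedLaguerre_succ (r + 1 + a) r x)).const_mul _)).congr_deriv ?_
      rw [show r + 1 + a - r = a + 1 by omega, show r + 1 + a - (r + 1) = a by omega,
        Nat.factorial_succ r]
      push_cast
      ring
    · obtain ⟨p, hp⟩ := exists_polynomial_shiftedLaguerre (r + 1 + a) r
      obtain ⟨q, hq⟩ := exists_polynomial_shiftedLaguerre (r + 1 + a) (r + 1)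
      have h := tendsto_exp_neg_mul_polynomial (Polynomial.X ^ (a + 1) * p * q)
      simpa [hp, hq, mul_assoc] using hA1.add (h.const_mul ((r ! : ℝ) / ((r + 1 + a)! : ℝ)))

theorem lintegral_hermiteDensity_of_le (j r : ℕ) (hr : r ≤ j) :
    ∫⁻ x in Set.Ioi (0 : ℝ), ENNReal.ofReal (hermiteDensity j r x) = 1 := by
  obtain ⟨A, hA, hA0, hA1⟩ := exists_antideriv_hermiteDensity j r hr
  have hpos : ∀ x ∈ Set.Ioi (0 : ℝ), 0 ≤ Real.exp (-x) * ((r ! : ℝ) / (j ! : ℝ)) * x ^ (j - r)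
      * shiftedLaguerre j r x ^ 2 := fun x hx => by
    have : 0 < x := hx
    positivity
  have h1 := integral_Ioi_of_hasDerivAt_of_nonneg' (fun x _ => hA x) hpos hA1
  have h2 := integrableOn_Ioi_deriv_of_nonneg' (fun x _ => hA x) hpos hA1
  have h3 : ∫⁻ x in Set.Ioi (0 : ℝ), ENNReal.ofReal (hermiteDensity j r x)
      = ∫⁻ x in Set.Ioi (0 : ℝ), ENNReal.ofReal (Real.exp (-x) * ((r ! : ℝ) / (j ! : ℝ))
        * x ^ (j - r) * shiftedLaguerre j r x ^ 2) := by
    refine setLIntegral_congr_fun measurableSet_Ioi fun x hx => ?_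
    have hx' : x ≠ 0 := ne_of_gt hx
    simp only [hermiteDensity]
    rw [pow_sub₀ x hx' hr, div_eq_mul_inv (x ^ j)]
  rw [h3, ← ofReal_integral_eq_lintegral_ofReal h2
    ((ae_restrict_iff' measurableSet_Ioi).2 (Eventually.of_forall hpos)), h1, hA0]
  simp

/-- Normalization of the complex Hermite functions. -/
theorem lintegral_hermiteDensity (j r : ℕ) :
    ∫⁻ x in Set.Ioi (0 : ℝ), ENNReal.ofReal (hermiteDensity j r x) = 1 := by
  rcases le_total r j with h | h
  · exact lintegral_hermiteDensity_of_le j r h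
  · rw [← lintegral_hermiteDensity_of_le r j h]
    exact setLIntegral_congr_fun measurableSet_Ioi fun x hx => by
      simp only [hermiteDensity_symm j r hx]

/-! ### The lowest Landau level -/

theorem pow_mul_exp_neg_div_factorial_le (n : ℕ) :
    Real.exp (-((n + 1 : ℕ) : ℝ)) * ((n + 1 : ℕ) : ℝ) ^ (n + 1) / (n ! : ℝ)
      ≤ √((n + 1 : ℕ) : ℝ) / 2 := by
  have h := Stirling.le_factorial_stirling (n + 1)
  -- Only `2π ≥ 4` is kept from the Stirling constant; it gives the `1/2` in the bound.
  have h1 : 2 * √((n + 1 : ℕ) : ℝ) ≤ √(2 * Real.pi * ((n + 1 : ℕ) : ℝ)) := by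
    refine Real.le_sqrt_of_sq_le ?_
    rw [mul_pow, Real.sq_sqrt (by positivity)]
    have := Real.pi_gt_three
    gcongr
    linarith
  have h2 : (((n + 1 : ℕ) : ℝ) / Real.exp 1) ^ (n + 1)
      = Real.exp (-((n + 1 : ℕ) : ℝ)) * ((n + 1 : ℕ) : ℝ) ^ (n + 1) := by
    rw [div_pow, ← Real.exp_nat_mul, mul_one, Real.exp_neg]
    field_simp
  rw [h2, Nat.factorial_succ] at h
  set w := Real.exp (-((n + 1 : ℕ) : ℝ)) * ((n + 1 : ℕ) : ℝ) ^ (n + 1) with hw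
  have hw0 : 0 ≤ w := by positivity
  have hs : √((n + 1 : ℕ) : ℝ) * √((n + 1 : ℕ) : ℝ) = ((n + 1 : ℕ) : ℝ) :=
    Real.mul_self_sqrt (by positivity)
  have hs0 : 0 < √((n + 1 : ℕ) : ℝ) := by positivity
  have h3 : 2 * √((n + 1 : ℕ) : ℝ) * w ≤ ((n + 1 : ℕ) : ℝ) * (n ! : ℝ) :=
    (mul_le_mul_of_nonneg_right h1 hw0).trans (by exact_mod_cast h)
  rw [div_le_div_iff₀ (by positivity) two_pos]
  refine le_of_mul_le_mul_left ?_ hs0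
  linear_combination h3 - (n ! : ℝ) * hs

/-- The linear factor is centred at the edge `x = n + 1`, so there only the Stirling term survives.
-/
theorem hasDerivAt_antideriv_poissonCDF (n : ℕ) (x : ℝ) :
    HasDerivAt (fun x => (x - (n + 1 : ℕ)) * poissonCDF (n + 1) x
      - Real.exp (-x) * x ^ (n + 1) / (n ! : ℝ)) (poissonCDF (n + 1) x) x := by
  refine ((((hasDerivAt_id x).sub_const _).fun_mul (hasDerivAt_poissonCDF_succ n x)).fun_sub
    (((hasDerivAt_exp_neg x).fun_mul (hasDerivAt_pow (n + 1) x)).div_const _)).congr_deriv ?_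
  simp only [id]
  push_cast
  field_simp
  ring

theorem continuous_poissonCDF (n : ℕ) : Continuous (poissonCDF n) := by
  unfold poissonCDF
  fun_prop

theorem lintegral_Ici_poissonCDF (n : ℕ) :
    ∫⁻ x in Set.Ici ((n + 1 : ℕ) : ℝ), ENNReal.ofReal (poissonCDF (n + 1) x)
      ≤ ENNReal.ofReal (√((n + 1 : ℕ) : ℝ) / 2) := by
  have hlim : Tendsto (fun x => (x - (n + 1 : ℕ)) * poissonCDF (n + 1) x
      - Real.exp (-x) * x ^ (n + 1) / (n ! : ℝ)) atTop (𝓝 0) := by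
    have h1 := tendsto_mul_poissonCDF (n + 1) 1 (-(n + 1 : ℕ))
    have h2 := (tendsto_exp_neg_mul_pow (n + 1)).div_const (n ! : ℝ)
    simpa [sub_eq_add_neg] using h1.sub h2
  have hpos : ∀ x ∈ Set.Ioi ((n + 1 : ℕ) : ℝ), 0 ≤ poissonCDF (n + 1) x := fun x hx =>
    poissonCDF_nonneg _ ((Nat.cast_nonneg _).trans (le_of_lt hx))
  have h1 := integral_Ioi_of_hasDerivAt_of_nonneg'
    (fun x _ => hasDerivAt_antideriv_poissonCDF n x) hpos hlim
  have h2 := integrableOn_Ioi_deriv_of_nonneg'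
    (fun x _ => hasDerivAt_antideriv_poissonCDF n x) hpos hlim
  rw [← setLIntegral_congr Ioi_ae_eq_Ici, ← ofReal_integral_eq_lintegral_ofReal h2
    ((ae_restrict_iff' measurableSet_Ioi).2 (Eventually.of_forall hpos)), h1]
  refine ENNReal.ofReal_le_ofReal ?_
  simpa using pow_mul_exp_neg_div_factorial_le n

/-- The mass missing inside the edge equals the mass leaking outside: the antiderivative of `1 -
poissonCDF` takes the value `n + 1` at `0`, which cancels the length of the interval. -/
theorem lintegral_Ioo_one_sub_poissonCDF (n : ℕ) :
    ∫⁻ x in Set.Ioo (0 : ℝ) ((n + 1 : ℕ) : ℝ), ENNReal.ofReal (1 - poissonCDF (n + 1) x)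
      ≤ ENNReal.ofReal (√((n + 1 : ℕ) : ℝ) / 2) := by
  have hc : Continuous fun x => 1 - poissonCDF (n + 1) x :=
    continuous_const.sub (continuous_poissonCDF _)
  have hpos : ∀ x ∈ Set.Ioc (0 : ℝ) ((n + 1 : ℕ) : ℝ), 0 ≤ 1 - poissonCDF (n + 1) x :=
    fun x hx => sub_nonneg.2 (poissonCDF_le_one _ (le_of_lt hx.1))
  have h1 := intervalIntegral.integral_eq_sub_of_hasDerivAt (a := 0) (b := ((n + 1 : ℕ) : ℝ))
    (fun x _ => (hasDerivAt_id x).fun_sub (hasDerivAt_antideriv_poissonCDF n x))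
    (hc.intervalIntegrable _ _)
  rw [intervalIntegral.integral_of_le (Nat.cast_nonneg _)] at h1
  rw [setLIntegral_congr Ioo_ae_eq_Ioc, ← ofReal_integral_eq_lintegral_ofReal
    ((hc.integrableOn_Icc).mono_set Set.Ioc_subset_Icc_self)
    ((ae_restrict_iff' measurableSet_Ioc).2 (Eventually.of_forall hpos)), h1]
  refine ENNReal.ofReal_le_ofReal ?_
  have := pow_mul_exp_neg_div_factorial_le n
  simp [poissonCDF_succ_zero] at this ⊢
  linarith

theorem lintegral_poissonCDF_sub_indicator_le (N : ℕ) :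
    ∫⁻ x in Set.Ioi (0 : ℝ), ‖poissonCDF N x - (Set.Iio (N : ℝ)).indicator (fun _ => 1) x‖ₑ
      ≤ ENNReal.ofReal √(N : ℝ) := by
  cases N with
  | zero =>
    rw [setLIntegral_congr_fun (g := fun _ => 0) measurableSet_Ioi fun x hx => ?_]
    · simp
    · have : ¬ x < 0 := not_lt.2 (le_of_lt hx)
      simp [poissonCDF, this]
  | succ n =>
    have hn : (0 : ℝ) < ((n + 1 : ℕ) : ℝ) := by positivity
    rw [← Set.Ioo_union_Ici_eq_Ioi hn, lintegral_union measurableSet_Ici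
      (Set.disjoint_left.2 fun x hx hx' => not_lt.2 hx' hx.2)]
    have h1 : ∀ x ∈ Set.Ioo (0 : ℝ) ((n + 1 : ℕ) : ℝ), ‖poissonCDF (n + 1) x
        - (Set.Iio ((n + 1 : ℕ) : ℝ)).indicator (fun _ => 1) x‖ₑ
        = ENNReal.ofReal (1 - poissonCDF (n + 1) x) := fun x hx => by
      rw [Set.indicator_of_mem (show x ∈ Set.Iio _ from hx.2), Real.enorm_eq_ofReal_abs,
        abs_sub_comm, abs_of_nonneg (sub_nonneg.2 (poissonCDF_le_one _ hx.1.le))]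
    have h2 : ∀ x ∈ Set.Ici ((n + 1 : ℕ) : ℝ), ‖poissonCDF (n + 1) x
        - (Set.Iio ((n + 1 : ℕ) : ℝ)).indicator (fun _ => 1) x‖ₑ
        = ENNReal.ofReal (poissonCDF (n + 1) x) := fun x hx => by
      rw [Set.indicator_of_notMem (show x ∉ Set.Iio ((n + 1 : ℕ) : ℝ) from Set.notMem_Iio.2 hx), sub_zero,
        Real.enorm_of_nonneg (poissonCDF_nonneg _ (hn.le.trans hx))]
    rw [setLIntegral_congr_fun measurableSet_Ioo h1, setLIntegral_congr_fun measurableSet_Ici h2]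
    refine (add_le_add (lintegral_Ioo_one_sub_poissonCDF n)
      (lintegral_Ici_poissonCDF n)).trans_eq ?_
    rw [← ENNReal.ofReal_add (by positivity) (by positivity), add_halves]

/-! ### Comparison of consecutive Landau levels -/

/-- The intensity `ρ_{r,N}` as a function of `x = π |z|²`. -/
noncomputable def landauDensity (r N : ℕ) (x : ℝ) : ℝ :=
  ∑ j ∈ Finset.range N, hermiteDensity j r x

theorem measurable_landauDensity (r N : ℕ) : Measurable (landauDensity r N) :=
  Finset.measurable_fun_sum _ fun j _ => measurable_hermiteDensity j r

theorem landauDensity_zero (N : ℕ) : landauDensity 0 N = poissonCDF N := by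
  ext x
  refine Finset.sum_congr rfl fun j _ => ?_
  simp [hermiteDensity, shiftedLaguerre_zero]
  ring

/-- The difference of the intensities of two consecutive Landau levels, as a function
of `x = π |z|²`. -/
noncomputable def levelDifference (r N : ℕ) (x : ℝ) : ℝ :=
  Real.exp (-x) * ((r ! : ℝ) / (N ! : ℝ)) * (x ^ N / x ^ (r + 1)) * N
    * shiftedLaguerre N (r + 1) x * shiftedLaguerre (N - 1) r x

/-- Both boundary terms are expressed through the two polynomials of index `j`: Pascal's rule
rewrites the one at `j + 1`, the three-term relation the one at `j`. The mixed products then cancel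
and two squares remain. -/
theorem hermiteDensity_sub_hermiteDensity (j r : ℕ) {x : ℝ} (hx : 0 < x) :
    hermiteDensity j r x - hermiteDensity j (r + 1) x
      = levelDifference r (j + 1) x - levelDifference r j x := by
  have h := shiftedLaguerre_succ_right j r x
  unfold hermiteDensity levelDifference
  rw [Nat.add_sub_cancel, shiftedLaguerre_succ_left, Nat.factorial_succ, Nat.factorial_succ]
  push_cast
  field_simp
  linear_combination (-x ^ j * x ^ r * shiftedLaguerre j (r + 1) x) * h

theorem landauDensity_sub_landauDensity (r N : ℕ) {x : ℝ} (hx : 0 < x) :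
    landauDensity r N x - landauDensity (r + 1) N x = levelDifference r N x := by
  rw [landauDensity, landauDensity, ← Finset.sum_sub_distrib,
    Finset.sum_congr rfl fun j _ => hermiteDensity_sub_hermiteDensity j r hx,
    Finset.sum_range_sub fun j => levelDifference r j x]
  -- The lower boundary term, at index `0`, vanishes because of its factor `N`.
  simp [levelDifference]

theorem levelDifference_sq (r n : ℕ) {x : ℝ} (hx : 0 < x) :
    levelDifference r (n + 1) x ^ 2
      = (n + 1) / (r + 1) * (hermiteDensity (n + 1) (r + 1) x * hermiteDensity n r x) := by
  unfold hermiteDensity levelDifference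
  rw [Nat.add_sub_cancel, Nat.factorial_succ, Nat.factorial_succ]
  push_cast
  field_simp
  ring

/-- AM-GM trades the product of densities for their sum, whose integral is known exactly. Discarding
`1/(r+1)` makes the constant independent of the level. -/
theorem abs_levelDifference_le (r n : ℕ) {x : ℝ} (hx : 0 < x) :
    |levelDifference r (n + 1) x| ≤ √((n + 1 : ℕ) : ℝ) / 2 *
      (hermiteDensity (n + 1) (r + 1) x + hermiteDensity n r x) := by
  have h1 := hermiteDensity_nonneg (n + 1) (r + 1) hx.le
  have h2 := hermiteDensity_nonneg n r hx.le
  refine abs_le_of_sq_le_sq ?_ (by positivity)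
  rw [levelDifference_sq r n hx, mul_pow, div_pow, Real.sq_sqrt (by positivity)]
  set a := hermiteDensity (n + 1) (r + 1) x
  set b := hermiteDensity n r x
  calc ((n : ℝ) + 1) / (r + 1) * (a * b) ≤ (n + 1) * (a * b) := by
        gcongr
        exact div_le_self (by positivity) (by linarith [(Nat.cast_nonneg r : (0 : ℝ) ≤ r)])
    _ ≤ (n + 1) * ((a + b) ^ 2 / 4) := by
        gcongr
        linarith [sq_nonneg (a - b)]
    _ = _ := by push_cast; ring

theorem lintegral_levelDifference_le (r N : ℕ) :
    ∫⁻ x in Set.Ioi (0 : ℝ), ‖levelDifference r N x‖ₑ ≤ ENNReal.ofReal √(N : ℝ) := by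
  cases N with
  | zero => simp [levelDifference]
  | succ n =>
    calc ∫⁻ x in Set.Ioi (0 : ℝ), ‖levelDifference r (n + 1) x‖ₑ
        ≤ ∫⁻ x in Set.Ioi (0 : ℝ), ENNReal.ofReal (√((n + 1 : ℕ) : ℝ) / 2) *
          (ENNReal.ofReal (hermiteDensity (n + 1) (r + 1) x)
            + ENNReal.ofReal (hermiteDensity n r x)) := by
          refine setLIntegral_mono' measurableSet_Ioi fun x hx => ?_
          have h1 := hermiteDensity_nonneg (n + 1) (r + 1) (le_of_lt hx)
          have h2 := hermiteDensity_nonneg n r (le_of_lt hx)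
          rw [Real.enorm_eq_ofReal_abs, ← ENNReal.ofReal_add h1 h2,
            ← ENNReal.ofReal_mul (by positivity)]
          exact ENNReal.ofReal_le_ofReal (abs_levelDifference_le r n hx)
      _ = ENNReal.ofReal √((n + 1 : ℕ) : ℝ) := by
          rw [lintegral_const_mul' _ _ ENNReal.ofReal_ne_top,
            lintegral_add_left (measurable_hermiteDensity _ _).ennreal_ofReal,
            lintegral_hermiteDensity, lintegral_hermiteDensity,
            ← ENNReal.ofReal_one, ← ENNReal.ofReal_add zero_le_one zero_le_one,
            ← ENNReal.ofReal_mul (by positivity)]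
          congr 1
          ring

theorem lintegral_landauDensity_sub_indicator_le (r N : ℕ) :
    ∫⁻ x in Set.Ioi (0 : ℝ), ‖landauDensity r N x - (Set.Iio (N : ℝ)).indicator (fun _ => 1) x‖ₑ
      ≤ ENNReal.ofReal ((r + 1) * √(N : ℝ)) := by
  induction r with
  | zero => simpa [landauDensity_zero] using lintegral_poissonCDF_sub_indicator_le N
  | succ r ih =>
    have hm : Measurable fun x : ℝ => ‖landauDensity r N x
        - (Set.Iio (N : ℝ)).indicator (fun _ => 1) x‖ₑ :=
      ((measurable_landauDensity r N).sub
        (measurable_const.indicator measurableSet_Iio)).enorm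
    calc _ ≤ ∫⁻ x in Set.Ioi (0 : ℝ), (‖landauDensity r N x
          - (Set.Iio (N : ℝ)).indicator (fun _ => 1) x‖ₑ + ‖levelDifference r N x‖ₑ) := by
          refine setLIntegral_mono' measurableSet_Ioi fun x hx => ?_
          rw [← landauDensity_sub_landauDensity r N hx]
          refine le_trans (le_of_eq ?_) (enorm_sub_le)
          congr 1
          ring
      _ ≤ ENNReal.ofReal ((r + 1) * √(N : ℝ)) + ENNReal.ofReal √(N : ℝ) := by
          rw [lintegral_add_left hm]
          exact add_le_add ih (lintegral_levelDifference_le r N)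
      _ = _ := by
          rw [← ENNReal.ofReal_add (by positivity) (by positivity)]
          congr 1
          push_cast
          ring

/-! ### Transfer from the half-line to the plane -/

/-- Polar coordinates followed by `x = c t²`: since `dx = 2ct dt`, the angular factor `2π` becomes
`π/c`. -/
theorem lintegral_comp_mul_norm_sq {F : ℝ → ℝ≥0∞} (hF : Measurable F) {c : ℝ} (hc : 0 < c) :
    ∫⁻ z : ℂ, F (c * ‖z‖ ^ 2)
      = ENNReal.ofReal (Real.pi / c) * ∫⁻ x in Set.Ioi (0 : ℝ), F x := by
  have himage : (fun t : ℝ => c * t ^ 2) '' Set.Ioi 0 = Set.Ioi 0 := by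
    ext y
    constructor
    · rintro ⟨t, ht, rfl⟩
      have ht' : 0 < t := ht
      exact Set.mem_Ioi.2 (by positivity)
    · intro hy
      have hy' : 0 < y := hy
      refine ⟨√(y / c), Real.sqrt_pos.2 (by positivity), ?_⟩
      simp only
      rw [Real.sq_sqrt (by positivity)]
      field_simp
  have hinj : Set.InjOn (fun t : ℝ => c * t ^ 2) (Set.Ioi 0) := fun a ha b hb hab => by
    have h : a ^ 2 = b ^ 2 := mul_left_cancel₀ hc.ne' hab
    exact (pow_left_inj₀ (le_of_lt ha) (le_of_lt hb) two_ne_zero).1 h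
  have hderiv : ∀ t ∈ Set.Ioi (0 : ℝ),
      HasDerivWithinAt (fun t : ℝ => c * t ^ 2) (c * (2 * t)) (Set.Ioi 0) t := fun t _ => by
    simpa using ((hasDerivAt_pow 2 t).const_mul c).hasDerivWithinAt
  have h1 := lintegral_image_eq_lintegral_abs_deriv_mul measurableSet_Ioi hderiv hinj F
  rw [himage] at h1
  have hpc : ENNReal.ofReal (Real.pi / c) ≠ ⊤ := ENNReal.ofReal_ne_top
  rw [h1, ← lintegral_const_mul' _ _ hpc, ← Complex.lintegral_comp_polarCoord_symm,
    polarCoord_target, Measure.volume_eq_prod, ← Measure.prod_restrict, lintegral_prod]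
  · refine setLIntegral_congr_fun measurableSet_Ioi fun t ht => ?_
    have ht' : 0 < t := ht
    simp only [Complex.norm_polarCoord_symm, sq_abs, smul_eq_mul, lintegral_const,
      Measure.restrict_apply_univ, Real.volume_Ioo]
    rw [← mul_assoc, ← ENNReal.ofReal_mul (by positivity), mul_right_comm,
      ← ENNReal.ofReal_mul ht'.le, abs_of_pos (by positivity)]
    congr 2
    field_simp
    ring
  · simp only [Complex.norm_polarCoord_symm]
    exact Measurable.aemeasurable (by fun_prop)

theorem exp_mul_norm_sq_eq_hermiteDensity (r a : ℕ) {z : ℂ} (hz : z ≠ 0) :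
    Real.exp (-(Real.pi * ‖z‖ ^ 2)) * (√((r ! : ℝ) / ((r + a)! : ℝ)) * √Real.pi ^ a * ‖z‖ ^ a
      * laguerre r a (Real.pi * ‖z‖ ^ 2)) ^ 2
      = hermiteDensity (r + a) r (Real.pi * ‖z‖ ^ 2) := by
  have hx : (Real.pi * ‖z‖ ^ 2) ≠ 0 := by
    have := norm_pos_iff.2 hz
    positivity
  have h1 : (√Real.pi ^ a) ^ 2 = Real.pi ^ a := by
    rw [← pow_mul, mul_comm, pow_mul, Real.sq_sqrt Real.pi_pos.le]
  rw [hermiteDensity, laguerre_eq_shiftedLaguerre, mul_pow, mul_pow, mul_pow,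
    Real.sq_sqrt (by positivity), h1, pow_add, mul_div_cancel_left₀ _ (pow_ne_zero r hx)]
  ring

theorem exp_mul_normSq_complexHermite (j r : ℕ) {z : ℂ} (hz : z ≠ 0) :
    Real.exp (-(Real.pi * ‖z‖ ^ 2)) * ‖complexHermite j r z‖ ^ 2
      = hermiteDensity j r (Real.pi * ‖z‖ ^ 2) := by
  have hx : 0 < Real.pi * ‖z‖ ^ 2 := by
    have := norm_pos_iff.2 hz
    positivity
  rcases lt_or_ge r j with h | h
  · obtain ⟨a, rfl⟩ := Nat.exists_eq_add_of_le h.le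
    rw [← exp_mul_norm_sq_eq_hermiteDensity r a hz, complexHermite, if_pos h,
      Nat.add_sub_cancel_left]
    simp only [norm_mul, norm_pow, Complex.norm_real, Real.norm_eq_abs, mul_pow, sq_abs,
      abs_of_nonneg (Real.sqrt_nonneg _)]
  · obtain ⟨a, rfl⟩ := Nat.exists_eq_add_of_le h
    rw [hermiteDensity_symm _ _ hx, ← exp_mul_norm_sq_eq_hermiteDensity j a hz, complexHermite,
      if_neg (not_lt.2 h), Nat.add_sub_cancel_left]
    simp only [norm_mul, norm_pow, Complex.norm_real, Real.norm_eq_abs, mul_pow, sq_abs,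
      abs_of_nonneg (Real.sqrt_nonneg _),
      norm_neg, norm_one, one_pow, one_mul, RCLike.norm_conj]

theorem pureIntensity_eq_sum (r N : ℕ) (z : ℂ) :
    pureIntensity r N z = ∑ j ∈ Finset.range N,
      Real.exp (-(Real.pi * ‖z‖ ^ 2)) * ‖complexHermite j r z‖ ^ 2 := by
  have h := ofReal_pureIntensity r N z
  rw [← Complex.ofReal_inj, h, pureKernel, ← Finset.mul_sum]
  simp only [Complex.mul_conj, Complex.normSq_eq_norm_sq]
  push_cast
  congr 2
  ring

theorem pureIntensity_eq_landauDensity (r N : ℕ) {z : ℂ} (hz : z ≠ 0) :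
    pureIntensity r N z = landauDensity r N (Real.pi * ‖z‖ ^ 2) := by
  rw [pureIntensity_eq_sum]
  exact Finset.sum_congr rfl fun j _ => exp_mul_normSq_complexHermite j r hz

theorem continuous_complexHermite (j r : ℕ) : Continuous (complexHermite j r) := by
  unfold complexHermite laguerre
  split_ifs <;> fun_prop

theorem continuous_pureIntensity (r N : ℕ) : Continuous (pureIntensity r N) := by
  have h := continuous_complexHermite
  rw [funext (pureIntensity_eq_sum r N)]
  fun_prop

/-- The `L¹` estimate at an arbitrary scale `s > 0`. -/
theorem eLpNorm_pureIntensity_scaled_sub_indicator_le (r N : ℕ) {s : ℝ} (hs : 0 < s) :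
    eLpNorm (fun z : ℂ => pureIntensity r N ((s : ℂ) * z)
        - (Metric.ball (0 : ℂ) (√((N : ℝ) / Real.pi) / s)).indicator (fun _ => (1 : ℝ)) z) 1 volume
      ≤ ENNReal.ofReal ((r + 1) * √(N : ℝ) / s ^ 2) := by
  have hc : 0 < Real.pi * s ^ 2 := by positivity
  rw [eLpNorm_one_eq_lintegral_enorm]
  -- The origin is removed because the quotient `x ^ j / x ^ r` in the radial density has a default
  -- value at `x = 0`.
  have hae : ∀ᵐ z : ℂ, z ≠ 0 := by simp [ae_iff]
  have hm : Measurable fun x : ℝ => ‖landauDensity r N x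
      - (Set.Iio (N : ℝ)).indicator (fun _ => 1) x‖ₑ :=
    ((measurable_landauDensity r N).sub (measurable_const.indicator measurableSet_Iio)).enorm
  have h1 : ∫⁻ z : ℂ, ‖pureIntensity r N ((s : ℂ) * z)
      - (Metric.ball (0 : ℂ) (√((N : ℝ) / Real.pi) / s)).indicator (fun _ => (1 : ℝ)) z‖ₑ
      = ∫⁻ z : ℂ, ‖landauDensity r N (Real.pi * s ^ 2 * ‖z‖ ^ 2)
        - (Set.Iio (N : ℝ)).indicator (fun _ => 1) (Real.pi * s ^ 2 * ‖z‖ ^ 2)‖ₑ := by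
    refine lintegral_congr_ae ?_
    filter_upwards [hae] with z hz
    have hsz : (s : ℂ) * z ≠ 0 := mul_ne_zero (Complex.ofReal_ne_zero.2 hs.ne') hz
    have h2 : Real.pi * ‖(s : ℂ) * z‖ ^ 2 = Real.pi * s ^ 2 * ‖z‖ ^ 2 := by
      rw [norm_mul, Complex.norm_real, Real.norm_eq_abs, mul_pow, sq_abs, mul_assoc]
    have h3 : z ∈ Metric.ball (0 : ℂ) (√((N : ℝ) / Real.pi) / s)
        ↔ Real.pi * s ^ 2 * ‖z‖ ^ 2 ∈ Set.Iio (N : ℝ) := by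
      rw [mem_ball_zero_iff, lt_div_iff₀ hs, Real.lt_sqrt (by positivity),
        lt_div_iff₀ Real.pi_pos, Set.mem_Iio]
      ring_nf
    rw [pureIntensity_eq_landauDensity r N hsz, h2]
    by_cases h : z ∈ Metric.ball (0 : ℂ) (√((N : ℝ) / Real.pi) / s)
    · rw [Set.indicator_of_mem h, Set.indicator_of_mem (h3.1 h)]
    · rw [Set.indicator_of_notMem h, Set.indicator_of_notMem (mt h3.2 h)]
  rw [h1, lintegral_comp_mul_norm_sq hm hc]
  refine (mul_le_mul_right (lintegral_landauDensity_sub_indicator_le r N) _).trans_eq ?_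
  rw [← ENNReal.ofReal_mul (by positivity)]
  congr 1
  field_simp

/-! ### Rescaling and the limit -/

theorem eLpNorm_rescaled_pureIntensity_sub_indicator_le (r N : ℕ) (hN : N ≠ 0) :
    eLpNorm (fun z : ℂ => pureIntensity r N (((√((N : ℝ) / Real.pi) : ℝ) : ℂ) * z)
        - (Metric.ball (0 : ℂ) 1).indicator (fun _ => (1 : ℝ)) z) 1 volume
      ≤ ENNReal.ofReal ((r + 1) * Real.pi * (√(N : ℝ))⁻¹) := by
  have hN' : (0 : ℝ) < N := by positivity
  have hs : 0 < √((N : ℝ) / Real.pi) := Real.sqrt_pos.2 (by positivity)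
  have h := eLpNorm_pureIntensity_scaled_sub_indicator_le r N hs
  rw [div_self hs.ne', Real.sq_sqrt (by positivity)] at h
  refine h.trans_eq ?_
  congr 1
  have h1 : √(N : ℝ) * √(N : ℝ) = N := Real.mul_self_sqrt hN'.le
  have h2 : 0 < √(N : ℝ) := Real.sqrt_pos.2 hN'
  field_simp
  linear_combination h1

theorem memLp_rescaled_pureIntensity (r N : ℕ) :
    MemLp (fun z : ℂ => pureIntensity r N (((√((N : ℝ) / Real.pi) : ℝ) : ℂ) * z)) 1 volume := by
  rcases eq_or_ne N 0 with rfl | hN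
  · simp [pureIntensity_eq_sum]
  · have hi : MemLp ((Metric.ball (0 : ℂ) 1).indicator (fun _ => (1 : ℝ))) 1 volume :=
      memLp_indicator_const 1 Metric.isOpen_ball.measurableSet 1
        (Or.inr measure_ball_lt_top.ne)
    have hc : Continuous fun z : ℂ =>
        pureIntensity r N (((√((N : ℝ) / Real.pi) : ℝ) : ℂ) * z) :=
      (continuous_pureIntensity r N).comp (continuous_const.mul continuous_id)
    have hd : MemLp (fun z : ℂ => pureIntensity r N (((√((N : ℝ) / Real.pi) : ℝ) : ℂ) * z)
        - (Metric.ball (0 : ℂ) 1).indicator (fun _ => (1 : ℝ)) z) 1 volume :=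
      ⟨hc.aestronglyMeasurable.sub hi.1,
        (eLpNorm_rescaled_pureIntensity_sub_indicator_le r N hN).trans_lt ENNReal.ofReal_lt_top⟩
    exact (hd.add hi).ae_eq (Eventually.of_forall fun z => sub_add_cancel _ _)

theorem theorem1p1 (r : ℕ) :
    ((∀ N : ℕ, MemLp (fun z : ℂ => pureIntensity r N (((√((N : ℝ) / Real.pi) : ℝ) : ℂ) * z))
        1 volume) ∧
      Tendsto
        (fun N : ℕ => eLpNorm
          (fun z : ℂ => pureIntensity r N (((√((N : ℝ) / Real.pi) : ℝ) : ℂ) * z)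
            - (Metric.ball (0 : ℂ) 1).indicator (fun _ => (1 : ℝ)) z) 1 volume)
        atTop (𝓝 0)) ∧
    ∃ C : ℝ, ∀ N : ℕ,
      eLpNorm
        (fun z : ℂ => pureIntensity r N z
          - (Metric.ball (0 : ℂ) (√((N : ℝ) / Real.pi))).indicator (fun _ => (1 : ℝ)) z) 1 volume
        ≤ ENNReal.ofReal (C * √(N : ℝ)) := by
  refine ⟨⟨memLp_rescaled_pureIntensity r, ?_⟩, (r : ℝ) + 1, fun N => ?_⟩
  · have h1 : Tendsto (fun N : ℕ => ((r : ℝ) + 1) * Real.pi * (√(N : ℝ))⁻¹) atTop (𝓝 0) := by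
      have := (tendsto_inv_atTop_zero.comp
        (Real.tendsto_sqrt_atTop.comp tendsto_natCast_atTop_atTop)).const_mul
          (((r : ℝ) + 1) * Real.pi)
      simpa using this
    have h2 := ENNReal.tendsto_ofReal h1
    rw [ENNReal.ofReal_zero] at h2
    refine tendsto_of_tendsto_of_tendsto_of_le_of_le' tendsto_const_nhds h2
      (Eventually.of_forall fun _ => bot_le) ?_
    -- For `N = 0` the scale `√(N/π)` degenerates to `0`, so the bound is used only for `N ≠ 0`.
    filter_upwards [eventually_ne_atTop 0] with N hN
    exact eLpNorm_rescaled_pureIntensity_sub_indicator_le r N hN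
  · simpa using eLpNorm_pureIntensity_scaled_sub_indicator_le r N one_pos
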